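/- Let $\mathcal A$ be a von Neumann algebra acting on a complex Hilbert space, let $G$ be a group of normal $*$-automorphisms of $\mathcal A$, and let $\varphi$ be a state on $\mathcal A$. Then the following are equivalent. (1) $\varphi$ is normal, faithful and $G$-strongly quasi-invariant with uniformly bounded cocycle: there are self-adjoint elements $x_g\in\mathcal A$ $(g\in G)$ and a constant $\lambda>0$ such that $$\varphi(g(a))=\varphi(x_g a)\quad\text{for all } a\in\mathcal A,\ g\in G,\qquad \|x_g\|\le\lambda\quad\text{for all } g\in G.$$ (2) There exist a normal faithful $G$-invariant state $\psi$ on $\mathcal A$ and a positive invertible element $d\in\mathcal A$ such that $$\psi(a)=\varphi(da)\quad\text{for all } a\in\mathcal A,\qquad\text{and}\qquad [d,g(d)]=0\quad\text{for all } g\in G.$$ Moreover, if (1) holds, then $[d,g(d)]=0$ for all $g\in G$ whenever $\psi$ is a normal faithful $G$-invariant state on $\mathcal A$ and $d\in\mathcal A$ is a positive invertible element with $\psi(a)=\varphi(da)$ for all $a\in\mathcal A$. -/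

import Mathlib

namespace QuasiInvariantState

variable {H : Type*} [NormedAddCommGroup H] [InnerProductSpace ℂ H] [CompleteSpace H]

/-- The underlying `*`-algebra of a von Neumann algebra `M` of operators on `H`. -/
abbrev Alg (M : VonNeumannAlgebra H) : Type _ := ↥M.toStarSubalgebra

/-- The functional `a ↦ ∑ₙ ⟨ξₙ, a ηₙ⟩` on `M` attached to two square summable sequences of
vectors `ξ` and `η`. The series converges absolutely. -/
noncomputable def ultraweakForm (M : VonNeumannAlgebra H)
    (ξ η : lp (fun _ : ℕ => H) 2) (a : Alg M) : ℂ :=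
  ∑' n, inner ℂ (ξ n) ((a : H →L[ℂ] H) (η n))

/-- The `σ`-weak (ultraweak) topology of `M`: the coarsest topology that makes all the
functionals `a ↦ ∑ₙ ⟨ξₙ, a ηₙ⟩` continuous. -/
noncomputable abbrev sigmaWeak (M : VonNeumannAlgebra H) : TopologicalSpace (Alg M) :=
  ⨅ (ξ : lp (fun _ : ℕ => H) 2) (η : lp (fun _ : ℕ => H) 2),
    TopologicalSpace.induced (ultraweakForm M ξ η) inferInstance

/-- A linear functional on `M` is normal if it is `σ`-weakly continuous. -/
def IsNormal {M : VonNeumannAlgebra H} (φ : Alg M →ₗ[ℂ] ℂ) : Prop :=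
  @Continuous (Alg M) ℂ (sigmaWeak M) inferInstance φ

/-- A `*`-automorphism of `M` is normal if it is `σ`-weakly continuous. -/
def IsNormalAut {M : VonNeumannAlgebra H} (g : Alg M ≃⋆ₐ[ℂ] Alg M) : Prop :=
  @Continuous (Alg M) (Alg M) (sigmaWeak M) (sigmaWeak M) g

open scoped ComplexOrder in
/-- A state on `M`: a positive linear functional with value `1` at the unit. The order on `ℂ`
is the usual one, so `0 ≤ z` says that `z` is real and nonnegative. -/
structure IsState {M : VonNeumannAlgebra H} (φ : Alg M →ₗ[ℂ] ℂ) : Prop where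
  nonneg : ∀ a : Alg M, 0 ≤ φ (star a * a)
  map_one : φ 1 = 1

/-- A positive functional `φ` is faithful if `φ (a* a) = 0` only for `a = 0`. -/
def IsFaithful {M : VonNeumannAlgebra H} (φ : Alg M →ₗ[ℂ] ℂ) : Prop :=
  ∀ a : Alg M, φ (star a * a) = 0 → a = 0

/-- `φ` is invariant under the group `G` of `*`-automorphisms. -/
def IsInvariant {M : VonNeumannAlgebra H} (G : Subgroup (Alg M ≃⋆ₐ[ℂ] Alg M))
    (φ : Alg M →ₗ[ℂ] ℂ) : Prop :=
  ∀ g ∈ G, ∀ a : Alg M, φ (g a) = φ a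

/-- The family `(x g)` consists of Radon-Nikodym derivatives of the functionals `φ ∘ g` with
respect to `φ`, that is, `φ (g a) = φ (x g * a)`. For a faithful state `φ` there is at most one
such family, called the cocycle of `φ`, and `φ` is `G`-quasi-invariant when it exists. -/
def IsCocycle {M : VonNeumannAlgebra H} (G : Subgroup (Alg M ≃⋆ₐ[ℂ] Alg M))
    (φ : Alg M →ₗ[ℂ] ℂ) (x : G → Alg M) : Prop :=
  ∀ (g : G) (a : Alg M), φ ((g : Alg M ≃⋆ₐ[ℂ] Alg M) a) = φ (x g * a)

/-- `φ` is a normal faithful `G`-strongly quasi-invariant functional (the cocycle exists and is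
self-adjoint) whose cocycle is uniformly bounded. -/
def IsBoundedStronglyQuasiInvariant {M : VonNeumannAlgebra H}
    (G : Subgroup (Alg M ≃⋆ₐ[ℂ] Alg M)) (φ : Alg M →ₗ[ℂ] ℂ) : Prop :=
  IsNormal φ ∧ IsFaithful φ ∧
    ∃ x : G → Alg M, IsCocycle G φ x ∧ (∀ g, IsSelfAdjoint (x g)) ∧
      ∃ c : ℝ, 0 < c ∧ ∀ g, ‖x g‖ ≤ c

/-- `d` is a positive invertible element of `M`, `ψ` is a normal faithful `G`-invariant state, and
`ψ a = φ (d a)` for all `a`. -/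
structure IsInvariantDensity {M : VonNeumannAlgebra H} (G : Subgroup (Alg M ≃⋆ₐ[ℂ] Alg M))
    (φ ψ : Alg M →ₗ[ℂ] ℂ) (d : Alg M) : Prop where
  state : IsState ψ
  normal : IsNormal ψ
  faithful : IsFaithful ψ
  invariant : IsInvariant G ψ
  pos : (d : H →L[ℂ] H).IsPositive
  isUnit : IsUnit d
  eq : ∀ a : Alg M, ψ a = φ (d * a)

end QuasiInvariantState

/-!
The passage from an invariant state to the cocycle is a computation: if `ψ = φ (d ·)` is invariant,
then `x g = d * g⁻¹ (d⁻¹)` is the cocycle of `φ`; it is bounded by `‖d‖ ‖d⁻¹‖`, and it is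
self-adjoint because `d` and `g⁻¹ d` commute. Conversely, if `φ` has a cocycle `x`, then
`φ (d ·)` is invariant exactly when `d` is fixed by all the maps `T g y = x g * g⁻¹ y`, and then
self-adjointness of `x g` and `d` forces `d` and `g⁻¹ d` to commute (`commute_of_density`).

It remains to find a positive invertible fixed point of the maps `T g` when the cocycle is
self-adjoint and bounded. The cocycle identity `x h * h⁻¹ (x g) = x (g * h)` has two consequences:
the elements `x g` commute with each other (`cocycle_commute`), and `T h` permutes them. So the
supremum of the family `x` in the commutative von Neumann algebra it generates should be fixed.
Here this supremum is obtained as the upper bound of `x`, inside the double commutant of `x` and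
the centralizer of `φ`, at which `φ` is minimal. Bounded decreasing sequences converge strongly and
`φ` is normal, so a minimizer exists (`exists_minimal_upperBound`). The maps `T g` preserve both
the set of upper bounds and `φ`; since two commuting upper bounds have a meet and `φ` is faithful,
the minimizer is unique, hence fixed (`exists_fixed_density`). It dominates `x 1 = 1`, so it is
invertible.

Positivity of `φ (d ·)` needs more than `0 ≤ d`: it holds because `d` has a square root in the
centralizer of `φ` (`map_mul_nonneg`).
-/

namespace QuasiInvariantState

open scoped ComplexOrder
open Filter Topology

/-! ### Positive functionals on C⋆-algebras and their centralizers -/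

section CStar

variable {A : Type*} [CStarAlgebra A] [PartialOrder A] [StarOrderedRing A]

theorem continuous_of_positive (φ : A →ₚ[ℂ] ℂ) : Continuous φ := by
  obtain ⟨C, hC⟩ := φ.exists_norm_apply_le
  exact (φ.toLinearMap.mkContinuous C hC).continuous

/-- The degenerate case of the Cauchy-Schwarz inequality: the left kernel of `φ` is a left ideal
on which `φ` vanishes. -/
theorem map_mul_eq_zero (φ : A →ₚ[ℂ] ℂ) {a : A} (ha : φ (star a * a) = 0) (b : A) :
    φ (b * a) = 0 := by
  have h0 : ‖φ.toPreGNS a‖ = 0 := by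
    rw [φ.preGNS_norm_def]; simp [ha]
  have h := norm_inner_le_norm (𝕜 := ℂ) (φ.toPreGNS (star b)) (φ.toPreGNS a)
  rw [h0, mul_zero, φ.preGNS_inner_def] at h
  simpa using h

/-- The centralizer of a positive functional `φ`: the elements `y` with `φ (y a) = φ (a y)` for
all `a`. It is a norm closed `*`-subalgebra, hence stable under the continuous functional
calculus. -/
def functionalCentralizer (φ : A →ₚ[ℂ] ℂ) : StarSubalgebra ℂ A where
  carrier := {y | ∀ a, φ (y * a) = φ (a * y)}
  mul_mem' {y z} hy hz a := by rw [mul_assoc, hy, mul_assoc, hz, mul_assoc]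
  add_mem' {y z} hy hz a := by simp only [add_mul, mul_add, map_add, hy a, hz a]
  algebraMap_mem' r a := by rw [Algebra.commutes]
  star_mem' {y} hy a := by
    have h := congrArg star (hy (star a))
    rw [← map_star φ, ← map_star φ] at h
    simpa using h.symm

theorem mem_functionalCentralizer {φ : A →ₚ[ℂ] ℂ} {y : A} :
    y ∈ functionalCentralizer φ ↔ ∀ a, φ (y * a) = φ (a * y) := Iff.rfl

theorem isClosed_functionalCentralizer (φ : A →ₚ[ℂ] ℂ) :
    IsClosed (functionalCentralizer φ : Set A) := by
  have hφ := continuous_of_positive φ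
  have : (functionalCentralizer φ : Set A) = ⋂ a, {y | φ (y * a) = φ (a * y)} := by
    ext y; simp [mem_functionalCentralizer]
  rw [this]
  exact isClosed_iInter fun a => isClosed_eq (by fun_prop) (by fun_prop)

theorem cfc_mem_functionalCentralizer {φ : A →ₚ[ℂ] ℂ} {y : A} (hy : y ∈ functionalCentralizer φ)
    (f : ℂ → ℂ) : cfc f y ∈ functionalCentralizer φ :=
  StarAlgebra.elemental.le_of_mem (isClosed_functionalCentralizer φ) hy (cfc_mem_elemental f y)

theorem abs_mem_functionalCentralizer {φ : A →ₚ[ℂ] ℂ} {y : A} (hy : y ∈ functionalCentralizer φ)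
    (hsa : IsSelfAdjoint y) : CFC.abs y ∈ functionalCentralizer φ := by
  rw [CFC.abs_eq_cfcₙ_coe_norm ℂ y hsa.isStarNormal, cfcₙ_eq_cfc]
  exact cfc_mem_functionalCentralizer hy _

/-- A nonnegative element of the centralizer has a square root in the centralizer, which makes
`a ↦ φ (y a)` positive. -/
theorem map_mul_nonneg {φ : A →ₚ[ℂ] ℂ} {y : A} (hy : y ∈ functionalCentralizer φ) (h0 : 0 ≤ y)
    {b : A} (hb : 0 ≤ b) : 0 ≤ φ (y * b) := by
  have hsa : IsSelfAdjoint y := .of_nonneg h0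
  have hn : IsStarNormal y := hsa.isStarNormal
  set s : A := cfc (fun z : ℂ => ((√‖z‖ : ℝ) : ℂ)) y with hs
  have hss : s * s = y := by
    rw [hs, ← cfc_mul _ _ y (by fun_prop) (by fun_prop)]
    simp_rw [← Complex.ofReal_mul, Real.mul_self_sqrt (norm_nonneg _)]
    conv_rhs => rw [← CFC.abs_of_nonneg y h0, CFC.abs_eq_cfcₙ_coe_norm ℂ y hn, cfcₙ_eq_cfc]
    rfl
  have hstar : star s = s := by
    rw [hs, ← cfc_star]; simp
  have h1 : φ (y * b) = φ (star s * b * s) := by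
    rw [← hss, hstar, mul_assoc, cfc_mem_functionalCentralizer hy _ (s * b)]
  rw [h1]
  exact φ.map_nonneg (star_left_conjugate_nonneg hb s)

omit [StarOrderedRing A] in
theorem eq_of_forall_map_mul_eq {φ : A →ₚ[ℂ] ℂ} (hf : ∀ a, φ (star a * a) = 0 → a = 0) {y z : A}
    (h : ∀ a, φ (y * a) = φ (z * a)) : y = z := by
  have := hf (star (y - z)) (by rw [star_star, sub_mul, map_sub, h, sub_self])
  exact sub_eq_zero.mp (star_eq_zero.mp this)

theorem eq_of_le_of_map_eq {φ : A →ₚ[ℂ] ℂ} (hf : ∀ a, φ (star a * a) = 0 → a = 0) {y z : A}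
    (hle : y ≤ z) (h : φ z ≤ φ y) : y = z := by
  obtain ⟨s, hs⟩ := CStarAlgebra.nonneg_iff_eq_star_mul_self.mp (sub_nonneg.mpr hle)
  have h1 : φ (z - y) = 0 := le_antisymm (by rw [map_sub]; exact sub_nonpos.mpr h)
    (φ.map_nonneg (sub_nonneg.mpr hle))
  rw [hs] at h1
  rw [hf s h1, mul_zero] at hs
  exact (sub_eq_zero.mp hs).symm

/-- A faithful functional detects positivity: the negative part `y⁻ = s* s` is killed by testing
`y` against `s`, because `y y⁻ = -(y⁻)²`. -/
theorem nonneg_of_forall_map_mul_nonneg {φ : A →ₚ[ℂ] ℂ} (hf : ∀ a, φ (star a * a) = 0 → a = 0)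
    {y : A} (hy : IsSelfAdjoint y) (h : ∀ a, 0 ≤ φ (y * (star a * a))) : 0 ≤ y := by
  obtain ⟨s, hs⟩ := CStarAlgebra.nonneg_iff_eq_star_mul_self.mp (CFC.negPart_nonneg y)
  have h1 := h s
  have hsa : star y⁻ = y⁻ := (IsSelfAdjoint.of_nonneg (CFC.negPart_nonneg y)).star_eq
  have h2 : y * (star s * s) = -(star y⁻ * y⁻) := by
    rw [← hs, hsa]
    nth_rewrite 1 [← CFC.posPart_sub_negPart y hy]
    rw [sub_mul, CFC.posPart_mul_negPart, zero_sub]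
  rw [h2, map_neg] at h1
  have h3 := hf y⁻ (le_antisymm (neg_nonneg.mp h1) (φ.map_nonneg (star_mul_self_nonneg _)))
  rw [← CFC.posPart_sub_negPart y hy, h3, sub_zero]
  exact CFC.posPart_nonneg y

/-! ### Meets of commuting elements -/

/-- Since `(u - v)² ≤ (u + v)²` for commuting `u, v ≥ 0`, this is monotonicity of the square
root. -/
theorem abs_sub_le_add {u v : A} (hu : 0 ≤ u) (hv : 0 ≤ v) (huv : Commute u v) :
    CFC.abs (u - v) ≤ u + v := by
  have h1 : star (u - v) * (u - v) ≤ (u + v) * (u + v) := by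
    have h : (u + v) * (u + v) - star (u - v) * (u - v) = u * v + u * v + (u * v + u * v) := by
      rw [star_sub, (IsSelfAdjoint.of_nonneg hu).star_eq, (IsSelfAdjoint.of_nonneg hv).star_eq]
      simp only [add_mul, mul_add, sub_mul, mul_sub, ← huv.eq]
      abel
    have h0 := huv.mul_nonneg hu hv
    rw [← sub_nonneg, h]
    exact add_nonneg (add_nonneg h0 h0) (add_nonneg h0 h0)
  have h2 := CFC.sqrt_le_sqrt _ _ h1
  rwa [CFC.sqrt_mul_self (u + v) (add_nonneg hu hv)] at h2

/-- The element `(y + z - |y - z|) / 2`. For commuting self-adjoint `y` and `z` it is their greatest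
lower bound among the elements commuting with both; it has no such meaning otherwise. -/
noncomputable def commMeet (y z : A) : A := (2⁻¹ : ℝ) • (y + z - CFC.abs (y - z))

theorem le_commMeet {x y z : A} (hy : x ≤ y) (hz : x ≤ z) (hyz : Commute y z) (hxy : Commute x y)
    (hxz : Commute x z) : x ≤ commMeet y z := by
  have h := abs_sub_le_add (sub_nonneg.mpr hy) (sub_nonneg.mpr hz)
    ((hyz.sub_right hxy.symm).sub_left (hxz.sub_right rfl))
  rw [sub_sub_sub_cancel_right] at h
  have h1 : (2⁻¹ : ℝ) • (x + x) ≤ commMeet y z := by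
    refine smul_le_smul_of_nonneg_left ?_ (by norm_num)
    rw [← sub_nonneg] at h ⊢
    convert h using 1
    abel
  rwa [← two_smul ℝ x, smul_smul, inv_mul_cancel₀ two_ne_zero, one_smul] at h1

theorem commMeet_le_left {y z : A} (hsa : IsSelfAdjoint (y - z)) : commMeet y z ≤ y := by
  have h0 : 0 ≤ y - z + CFC.abs (y - z) := by
    rw [add_comm, CFC.abs_add_self _ hsa]
    exact nsmul_nonneg (CFC.posPart_nonneg _) 2
  have : commMeet y z ≤ (2⁻¹ : ℝ) • (y + y) := by
    refine smul_le_smul_of_nonneg_left ?_ (by norm_num)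
    rw [← sub_nonneg]
    convert h0 using 1
    abel
  rwa [← two_smul ℝ y, smul_smul, inv_mul_cancel₀ two_ne_zero, one_smul] at this

theorem commMeet_le_right {y z : A} (hsa : IsSelfAdjoint (y - z)) : commMeet y z ≤ z := by
  have h : commMeet y z = commMeet z y := by
    rw [commMeet, commMeet, ← neg_sub y z, CFC.abs_neg, add_comm]
  rw [h]
  exact commMeet_le_left (by simpa using hsa.neg)

theorem commute_commMeet {c y z : A} (hsa : IsSelfAdjoint (y - z)) (hy : Commute c y)
    (hz : Commute c z) : Commute c (commMeet y z) := by
  have h := hy.sub_right hz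
  have habs : Commute c (CFC.abs (y - z)) :=
    (Commute.cfcₙ_nnreal
      ((by rwa [hsa.star_eq] : Commute c (star (y - z))).mul_right h).symm _).symm
  exact ((hy.add_right hz).sub_right habs).smul_right _

theorem commMeet_mem_functionalCentralizer {φ : A →ₚ[ℂ] ℂ} {y z : A}
    (hsa : IsSelfAdjoint (y - z)) (hy : y ∈ functionalCentralizer φ)
    (hz : z ∈ functionalCentralizer φ) : commMeet y z ∈ functionalCentralizer φ := by
  have h := sub_mem (add_mem hy hz) (abs_mem_functionalCentralizer (sub_mem hy hz) hsa)
  have := (functionalCentralizer φ).smul_mem h (2⁻¹ : ℂ)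
  rw [commMeet]
  convert this using 1
  rw [← Complex.coe_smul]
  simp

end CStar

/-! ### Bounded cocycles and their least upper bounds -/

section Cocycle

variable {A : Type*} [CStarAlgebra A] [PartialOrder A] [StarOrderedRing A]
  {φ : A →ₚ[ℂ] ℂ} {G : Subgroup (A ≃⋆ₐ[ℂ] A)} {x : G → A}

omit [StarOrderedRing A] in
/-- The cocycle identity. With `T g y = x g * g⁻¹ y`, it says that `T h` sends `x g` to
`x (g * h)`. -/
theorem cocycle_mul (hf : ∀ a, φ (star a * a) = 0 → a = 0)
    (hx : ∀ (g : G) (a : A), φ ((g : A ≃⋆ₐ[ℂ] A) a) = φ (x g * a)) (g h : G) :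
    x h * (h⁻¹ : A ≃⋆ₐ[ℂ] A) (x g) = x (g * h) := by
  refine eq_of_forall_map_mul_eq hf fun a => ?_
  rw [← hx, mul_assoc, ← hx, map_mul, ← StarAlgEquiv.mul_apply, mul_inv_cancel,
    StarAlgEquiv.one_apply, ← hx, Subgroup.coe_mul, StarAlgEquiv.mul_apply]

omit [StarOrderedRing A] in
theorem cocycle_one (hf : ∀ a, φ (star a * a) = 0 → a = 0)
    (hx : ∀ (g : G) (a : A), φ ((g : A ≃⋆ₐ[ℂ] A) a) = φ (x g * a)) : x 1 = 1 :=
  eq_of_forall_map_mul_eq hf fun a => by rw [← hx, one_mul]; rfl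

theorem cocycle_nonneg (hf : ∀ a, φ (star a * a) = 0 → a = 0)
    (hx : ∀ (g : G) (a : A), φ ((g : A ≃⋆ₐ[ℂ] A) a) = φ (x g * a))
    (hsa : ∀ g, IsSelfAdjoint (x g)) (g : G) : 0 ≤ x g :=
  nonneg_of_forall_map_mul_nonneg hf (hsa g) fun a => by
    rw [← hx, map_mul, map_star]
    exact φ.map_nonneg (star_mul_self_nonneg _)

/-- By the cocycle identity `x h = x g * g⁻¹ (x (h * g⁻¹))` is a product of self-adjoint elements;
as it is self-adjoint itself, the factors commute, and `x g` commutes with the product. -/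
theorem cocycle_commute (hf : ∀ a, φ (star a * a) = 0 → a = 0)
    (hx : ∀ (g : G) (a : A), φ ((g : A ≃⋆ₐ[ℂ] A) a) = φ (x g * a))
    (hsa : ∀ g, IsSelfAdjoint (x g)) (g h : G) : Commute (x g) (x h) := by
  have h1 := cocycle_mul hf hx (h * g⁻¹) g
  rw [inv_mul_cancel_right] at h1
  have h2 : Commute (x g) ((g⁻¹ : A ≃⋆ₐ[ℂ] A) (x (h * g⁻¹))) :=
    ((hsa g).commute_iff ((hsa _).map _)).mpr (h1 ▸ hsa h)
  rw [← h1]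
  exact (Commute.refl _).mul_right h2

theorem cocycle_mem_functionalCentralizer
    (hx : ∀ (g : G) (a : A), φ ((g : A ≃⋆ₐ[ℂ] A) a) = φ (x g * a))
    (hsa : ∀ g, IsSelfAdjoint (x g)) (g : G) : x g ∈ functionalCentralizer φ := fun a => by
  have h := hx g (star a)
  rw [map_star, map_star φ, hx g] at h
  have h1 := congrArg star h
  rw [star_star, ← map_star φ, star_mul, star_star, (hsa g).star_eq] at h1
  exact h1

theorem isUnit_cocycle (hf : ∀ a, φ (star a * a) = 0 → a = 0)
    (hx : ∀ (g : G) (a : A), φ ((g : A ≃⋆ₐ[ℂ] A) a) = φ (x g * a))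
    (hsa : ∀ g, IsSelfAdjoint (x g)) (g : G) : IsUnit (x g) := by
  have h := cocycle_mul hf hx g⁻¹ g
  rw [inv_mul_cancel, cocycle_one hf hx] at h
  have hc : Commute (x g) ((g⁻¹ : A ≃⋆ₐ[ℂ] A) (x g⁻¹)) :=
    ((hsa g).commute_iff ((hsa _).map _)).mpr (h ▸ .one A)
  exact ⟨⟨_, _, h, hc.eq ▸ h⟩, rfl⟩

/-- `y` is an upper bound of the family `x` that lies in the centralizer of `φ` and in the double
commutant of `x`. For a cocycle `x` the second condition makes all such upper bounds commute. -/
structure IsCommutingUpperBound (φ : A →ₚ[ℂ] ℂ) (x : G → A) (y : A) : Prop where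
  comm : ∀ c, (∀ h, Commute c (x h)) → Commute c y
  mem : y ∈ functionalCentralizer φ
  le : ∀ h, x h ≤ y

theorem IsCommutingUpperBound.commute {y z : A} (hc : ∀ g h : G, Commute (x g) (x h))
    (hy : IsCommutingUpperBound φ x y) (hz : IsCommutingUpperBound φ x z) : Commute y z :=
  hz.comm _ fun h => (hy.comm _ fun g => hc h g).symm

theorem IsCommutingUpperBound.isSelfAdjoint {y : A} (hsa : ∀ g, IsSelfAdjoint (x g))
    (hy : IsCommutingUpperBound φ x y) : IsSelfAdjoint y := by
  simpa using (IsSelfAdjoint.of_nonneg (sub_nonneg.mpr (hy.le 1))).add (hsa 1)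

/-- The commuting upper bounds are directed downwards. -/
theorem IsCommutingUpperBound.exists_le {y z : A} (hc : ∀ g h : G, Commute (x g) (x h))
    (hsa : ∀ g, IsSelfAdjoint (x g))
    (hy : IsCommutingUpperBound φ x y) (hz : IsCommutingUpperBound φ x z) :
    ∃ w, IsCommutingUpperBound φ x w ∧ w ≤ y ∧ w ≤ z := by
  have hs := (hy.isSelfAdjoint hsa).sub (hz.isSelfAdjoint hsa)
  refine ⟨commMeet y z, ⟨fun c h => commute_commMeet hs (hy.comm c h) (hz.comm c h),
    commMeet_mem_functionalCentralizer hs hy.mem hz.mem, fun h => ?_⟩,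
    commMeet_le_left hs, commMeet_le_right hs⟩
  exact le_commMeet (hy.le h) (hz.le h) (hy.commute hc hz) (hy.comm _ fun g => hc h g)
    (hz.comm _ fun g => hc h g)

theorem isCommutingUpperBound_algebraMap (hsa : ∀ g, IsSelfAdjoint (x g)) {c : ℝ}
    (hx : ∀ g, ‖x g‖ ≤ c) : IsCommutingUpperBound φ x (algebraMap ℝ A c) where
  comm a _ := (Algebra.commutes c a).symm
  mem a := by rw [Algebra.commutes]
  le g := ((hsa g).le_algebraMap_norm_self).trans (algebraMap_mono A (hx g))

theorem map_nonneg_of_starAlgEquiv (g : A ≃⋆ₐ[ℂ] A) {y : A} (hy : 0 ≤ y) : 0 ≤ g y := by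
  obtain ⟨s, rfl⟩ := CStarAlgebra.nonneg_iff_eq_star_mul_self.mp hy
  rw [map_mul, map_star]
  exact star_mul_self_nonneg _

/-- The maps `y ↦ x g * g⁻¹ y` permute the family `x`, hence preserve its commuting upper
bounds. -/
theorem IsCommutingUpperBound.translate (hf : ∀ a, φ (star a * a) = 0 → a = 0)
    (hx : ∀ (g : G) (a : A), φ ((g : A ≃⋆ₐ[ℂ] A) a) = φ (x g * a))
    (hsa : ∀ g, IsSelfAdjoint (x g)) {y : A}
    (hy : IsCommutingUpperBound φ x y) (g : G) :
    IsCommutingUpperBound φ x (x g * (g⁻¹ : A ≃⋆ₐ[ℂ] A) y) := by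
  have hcy : ∀ c, (∀ h, Commute c (x h)) → Commute c ((g⁻¹ : A ≃⋆ₐ[ℂ] A) y) := fun c h => by
    -- `g c` commutes with `x k` since `c` commutes with `g⁻¹ (x k) = (x g)⁻¹ * x (k * g)`.
    have h1 : Commute ((g : A ≃⋆ₐ[ℂ] A) c) y := hy.comm _ fun k => by
      have h1 := cocycle_mul hf hx k g
      have h3 : Commute c ((g⁻¹ : A ≃⋆ₐ[ℂ] A) (x k)) := by
        refine (isUnit_cocycle hf hx hsa g).mul_left_cancel ?_
        rw [← mul_assoc, ← (h g).eq, mul_assoc, h1, (h (k * g)).eq, ← h1, mul_assoc]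
      have h4 := h3.map (g : A ≃⋆ₐ[ℂ] A)
      rwa [← StarAlgEquiv.mul_apply _ _ (x k), mul_inv_cancel, StarAlgEquiv.one_apply] at h4
    have h2 := h1.map (g⁻¹ : A ≃⋆ₐ[ℂ] A)
    rwa [← StarAlgEquiv.mul_apply, inv_mul_cancel, StarAlgEquiv.one_apply] at h2
  refine ⟨fun c h => (h g).mul_right (hcy c h), fun a => ?_, fun h => ?_⟩
  · have e : ∀ b : A, (g : A ≃⋆ₐ[ℂ] A) ((g⁻¹ : A ≃⋆ₐ[ℂ] A) b) = b := fun b => by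
      rw [← StarAlgEquiv.mul_apply, mul_inv_cancel, StarAlgEquiv.one_apply]
    have hcom := hcy (x g) fun k => cocycle_commute hf hx hsa g k
    rw [mul_assoc, ← hx, map_mul, e, hy.mem, hcom.eq, ← mul_assoc,
      ← cocycle_mem_functionalCentralizer hx hsa g, ← hx, map_mul (g : A ≃⋆ₐ[ℂ] A), e]
  · have h1 := cocycle_mul hf hx (h * g⁻¹) g
    rw [inv_mul_cancel_right] at h1
    rw [← h1, ← sub_nonneg, ← mul_sub, ← map_sub]
    refine Commute.mul_nonneg (cocycle_nonneg hf hx hsa g)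
      (map_nonneg_of_starAlgEquiv _ (sub_nonneg.mpr (hy.le _))) ?_
    rw [map_sub]
    refine (hcy _ fun k => cocycle_commute hf hx hsa g k).sub_right ?_
    exact ((hsa g).commute_iff ((hsa _).map _)).mpr (h1 ▸ hsa h)

omit [StarOrderedRing A] in
theorem map_translate
    (hx : ∀ (g : G) (a : A), φ ((g : A ≃⋆ₐ[ℂ] A) a) = φ (x g * a)) (y : A) (g : G) :
    φ (x g * (g⁻¹ : A ≃⋆ₐ[ℂ] A) y) = φ y := by
  rw [← hx, ← StarAlgEquiv.mul_apply, mul_inv_cancel, StarAlgEquiv.one_apply]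

/-- Every decreasing sequence `z` of nonnegative elements has a limit `w`, in the sense that `w`
dominates the lower bounds of `z`, lies in the double commutant of `z`, and `φ (a z b)` tends to
`φ (a w b)`. In a von Neumann algebra every normal `φ` has this property. -/
def IsMonotoneNormal (φ : A →ₚ[ℂ] ℂ) : Prop :=
  ∀ z : ℕ → A, Antitone z → (∀ n, 0 ≤ z n) → ∃ w,
    (∀ x, (∀ n, x ≤ z n) → x ≤ w) ∧ (∀ c, (∀ n, Commute c (z n)) → Commute c w) ∧
      ∀ a b, Tendsto (fun n => φ (a * z n * b)) atTop (𝓝 (φ (a * w * b)))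

/-- The functional `φ` attains its minimum on the commuting upper bounds of the cocycle: a
minimizing sequence can be made decreasing by taking meets. -/
theorem exists_minimal_upperBound (hnorm : IsMonotoneNormal φ)
    (hf : ∀ a, φ (star a * a) = 0 → a = 0)
    (hx : ∀ (g : G) (a : A), φ ((g : A ≃⋆ₐ[ℂ] A) a) = φ (x g * a))
    (hsa : ∀ g, IsSelfAdjoint (x g)) {c : ℝ} (hbd : ∀ g, ‖x g‖ ≤ c) :
    ∃ d, IsCommutingUpperBound φ x d ∧ ∀ y, IsCommutingUpperBound φ x y → φ d ≤ φ y := by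
  have hc := cocycle_commute hf hx hsa
  have hnn : ∀ y, IsCommutingUpperBound φ x y → 0 ≤ y := fun y hy =>
    (cocycle_nonneg hf hx hsa 1).trans (hy.le 1)
  have hre : ∀ y, IsCommutingUpperBound φ x y → ((φ y).re : ℂ) = φ y := fun y hy =>
    Complex.conj_eq_iff_re.mp (φ.map_nonneg (hnn y hy)).star_eq
  set R : Set ℝ := (fun y => (φ y).re) '' {y | IsCommutingUpperBound φ x y} with hR
  have hne : R.Nonempty := ⟨_, _, isCommutingUpperBound_algebraMap hsa hbd, rfl⟩
  have hbb : BddBelow R := ⟨0, by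
    rintro _ ⟨y, hy, rfl⟩
    exact (Complex.le_def.mp (φ.map_nonneg (hnn y hy))).1⟩
  obtain ⟨u, -, hu, huR⟩ := exists_seq_tendsto_sInf hne hbb
  choose y hyS hyu using huR
  choose! m hmS hml hmr using fun (y z : A) (h : IsCommutingUpperBound φ x y ∧
    IsCommutingUpperBound φ x z) => h.1.exists_le hc hsa h.2
  -- `z n` is a commuting upper bound of the cocycle below each of `y 0, ..., y n`.
  let z : ℕ → A := fun n => Nat.rec (y 0) (fun k w => m w (y (k + 1))) n
  have hzS : ∀ n, IsCommutingUpperBound φ x (z n) := fun n => by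
    induction n with
    | zero => exact hyS 0
    | succ k ih => exact hmS _ _ ⟨ih, hyS _⟩
  have hz : Antitone z := antitone_nat_of_succ_le fun n => hml _ _ ⟨hzS n, hyS _⟩
  have hzy : ∀ n, z n ≤ y n := fun n => by
    cases n with
    | zero => exact le_rfl
    | succ k => exact hmr _ _ ⟨hzS k, hyS _⟩
  obtain ⟨d, hd1, hd2, hd3⟩ := hnorm z hz fun n => hnn _ (hzS n)
  have hdS : IsCommutingUpperBound φ x d := by
    refine ⟨fun a ha => hd2 a fun n => (hzS n).comm a ha, fun a => ?_,
      fun h => hd1 _ fun n => (hzS n).le h⟩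
    have h1 := hd3 1 a
    have h2 := hd3 a 1
    simp only [one_mul, mul_one] at h1 h2
    refine tendsto_nhds_unique h1 (h2.congr fun n => ((hzS n).mem a).symm)
  have hlim : Tendsto (fun n => (φ (z n)).re) atTop (𝓝 (φ d).re) := by
    have h := hd3 1 1
    simp only [one_mul, mul_one] at h
    exact (Complex.continuous_re.tendsto _).comp h
  have hle : (φ d).re ≤ sInf R := le_of_tendsto_of_tendsto' hlim hu fun n => by
    rw [← hyu n]
    exact (Complex.le_def.mp (OrderHomClass.mono φ (hzy n))).1
  refine ⟨d, hdS, fun w hw => ?_⟩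
  rw [← hre d hdS, ← hre w hw, Complex.real_le_real]
  exact hle.trans (csInf_le hbb ⟨w, hw, rfl⟩)

/-- A minimizer `d` of `φ` is fixed by every `y ↦ x g * g⁻¹ y`: the translate of `d` is a minimizer
too, and a commuting upper bound below both has to be equal to both, as `φ` is faithful. -/
theorem exists_fixed_density (hnorm : IsMonotoneNormal φ) (hf : ∀ a, φ (star a * a) = 0 → a = 0)
    (hx : ∀ (g : G) (a : A), φ ((g : A ≃⋆ₐ[ℂ] A) a) = φ (x g * a))
    (hsa : ∀ g, IsSelfAdjoint (x g)) {c : ℝ} (hbd : ∀ g, ‖x g‖ ≤ c) :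
    ∃ d ∈ functionalCentralizer φ, 1 ≤ d ∧ ∀ g : G, x g * (g⁻¹ : A ≃⋆ₐ[ℂ] A) d = d := by
  obtain ⟨d, hd, hmin⟩ := exists_minimal_upperBound hnorm hf hx hsa hbd
  refine ⟨d, hd.mem, cocycle_one hf hx ▸ hd.le 1, fun g => ?_⟩
  obtain ⟨w, hw, hw1, hw2⟩ := hd.exists_le (cocycle_commute hf hx hsa) hsa
    (hd.translate hf hx hsa g)
  exact (eq_of_le_of_map_eq hf hw2 ((map_translate hx d g).le.trans (hmin w hw))).symm.trans
    (eq_of_le_of_map_eq hf hw1 (hmin w hw))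

/-- An invariant density satisfies `x g * g⁻¹ d = d`; since `d` is self-adjoint, the two factors
commute, so that `d` commutes with `g⁻¹ d`. -/
theorem commute_of_density (hf : ∀ a, φ (star a * a) = 0 → a = 0)
    (hx : ∀ (g : G) (a : A), φ ((g : A ≃⋆ₐ[ℂ] A) a) = φ (x g * a))
    (hsa : ∀ g, IsSelfAdjoint (x g)) {d : A} (hd : IsSelfAdjoint d)
    (hinv : ∀ (g : G) (a : A), φ (d * (g : A ≃⋆ₐ[ℂ] A) a) = φ (d * a)) (g : G) :
    Commute d ((g : A ≃⋆ₐ[ℂ] A) d) := by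
  have h (g : G) : x g * (g⁻¹ : A ≃⋆ₐ[ℂ] A) d = d := eq_of_forall_map_mul_eq hf fun a => by
    rw [mul_assoc, ← hx, map_mul, ← StarAlgEquiv.mul_apply, mul_inv_cancel,
      StarAlgEquiv.one_apply, hinv]
  have h1 := h g⁻¹
  rw [InvMemClass.coe_inv, inv_inv] at h1
  have h2 : Commute (x g⁻¹) ((g : A ≃⋆ₐ[ℂ] A) d) :=
    ((hsa _).commute_iff (hd.map _)).mpr (h1.symm ▸ hd)
  have h3 := h2.mul_left (Commute.refl _)
  rwa [h1] at h3

end Cocycle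

/-! ### Von Neumann algebras as ordered C⋆-algebras -/

section VonNeumann

variable {H : Type*} [NormedAddCommGroup H] [InnerProductSpace ℂ H] [CompleteSpace H]

/-- An operator in the double commutant of `M` belongs to `M`. -/
theorem mem_of_forall_commute (M : VonNeumannAlgebra H) {T : H →L[ℂ] H}
    (hT : ∀ c, (∀ a : Alg M, Commute c (a : H →L[ℂ] H)) → Commute c T) : T ∈ M := by
  change T ∈ (M : Set (H →L[ℂ] H))
  rw [← VonNeumannAlgebra.centralizer_centralizer M]
  intro c hc
  exact hT c fun a => (hc a a.2).symm

theorem isClosed_vonNeumannAlgebra (M : VonNeumannAlgebra H) :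
    IsClosed (M.toStarSubalgebra : Set (H →L[ℂ] H)) := by
  have h : (M.toStarSubalgebra : Set (H →L[ℂ] H)) = (M : Set (H →L[ℂ] H)) := rfl
  rw [h, ← VonNeumannAlgebra.centralizer_centralizer M]
  exact Set.isClosed_centralizer _

/-- A von Neumann algebra is a C⋆-algebra for the operator norm. The instance is scoped, so that
outside this namespace the ring structure of `Alg M` is found through `StarSubalgebra` only. -/
noncomputable scoped instance instCStarAlgebraAlg (M : VonNeumannAlgebra H) :
    CStarAlgebra (Alg M) :=
  StarSubalgebra.cstarAlgebra M.toStarSubalgebra (h_closed := isClosed_vonNeumannAlgebra M)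

/-- The operator order restricted to `M` is the order of the C⋆-algebra `M`: the square root of a
positive element of `M` lies in the double commutant of `M`. -/
instance instStarOrderedRingAlg (M : VonNeumannAlgebra H) : StarOrderedRing (Alg M) :=
  .of_nonneg_iff' (fun {x y} h z => add_le_add_right (α := H →L[ℂ] H) h z) fun a => by
    constructor
    · intro ha
      have ha' : (0 : H →L[ℂ] H) ≤ a := ha
      have hm : CFC.sqrt (a : H →L[ℂ] H) ∈ M := mem_of_forall_commute M fun c hc =>
        (Commute.cfcₙ_nnreal (hc a).symm _).symm
      refine ⟨⟨_, hm⟩, Subtype.ext ?_⟩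
      change (a : H →L[ℂ] H) = star (CFC.sqrt (a : H →L[ℂ] H)) * CFC.sqrt (a : H →L[ℂ] H)
      rw [(IsSelfAdjoint.of_nonneg (CFC.sqrt_nonneg _)).star_eq, CFC.sqrt_mul_sqrt_self _ ha']
    · rintro ⟨s, rfl⟩
      exact star_mul_self_nonneg (s : H →L[ℂ] H)

end VonNeumann

/-! ### Normal functionals and monotone limits -/

section Normal

variable {H : Type*} [NormedAddCommGroup H] [InnerProductSpace ℂ H] [CompleteSpace H]

theorem norm_apply_sq_le_of_nonneg {T : H →L[ℂ] H} (hT : 0 ≤ T) (v : H) :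
    ‖T v‖ ^ 2 ≤ ‖T‖ * (inner ℂ (T v) v).re := by
  set s := CFC.sqrt T with hs
  have hsa : star s = s := (IsSelfAdjoint.of_nonneg (CFC.sqrt_nonneg T)).star_eq
  have hss : s * s = T := CFC.sqrt_mul_sqrt_self T hT
  have h1 : inner ℂ (T v) v = ((‖s v‖ ^ 2 : ℝ) : ℂ) := by
    rw [← hss, mul_apply_eq_comp]
    nth_rewrite 1 [← hsa]
    rw [ContinuousLinearMap.star_eq_adjoint, ContinuousLinearMap.adjoint_inner_left,
      inner_self_eq_norm_sq_to_K]
    simp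
  have h2 : ‖T‖ = ‖s‖ ^ 2 := by
    rw [← hss, sq, ← CStarRing.norm_star_mul_self, hsa]
  have h3 : ‖T v‖ ≤ ‖s‖ * ‖s v‖ := by
    rw [← hss]
    exact s.le_opNorm _
  rw [h1, Complex.ofReal_re, h2, ← mul_pow]
  exact pow_le_pow_left₀ (norm_nonneg _) h3 2

/-- A decreasing sequence of positive operators converges strongly (Vigier's theorem for
sequences). -/
theorem exists_tendsto_of_antitone {z : ℕ → H →L[ℂ] H} (hz : Antitone z) (h0 : ∀ n, 0 ≤ z n) :
    ∃ w : H →L[ℂ] H, ∀ v, Tendsto (fun n => z n v) atTop (𝓝 (w v)) := by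
  have hbd : ∀ v, BddBelow (Set.range fun n => (inner ℂ (z n v) v).re) := fun v => ⟨0, by
    rintro _ ⟨n, rfl⟩
    exact ((ContinuousLinearMap.nonneg_iff_isPositive _).mp (h0 n)).re_inner_nonneg_left v⟩
  have hq : ∀ v, Antitone fun n => (inner ℂ (z n v) v).re := fun v n m hnm => by
    have h := ((ContinuousLinearMap.le_def _ _).mp (hz hnm)).re_inner_nonneg_left v
    rw [sub_apply, inner_sub_left] at h
    simpa using h
  have hC : ∀ v, CauchySeq fun n => z n v := fun v => by
    have hcau := (tendsto_atTop_ciInf (hq v) (hbd v)).cauchySeq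
    rw [Metric.cauchySeq_iff'] at hcau ⊢
    intro ε hε
    obtain ⟨N, hN⟩ := hcau (ε ^ 2 / (‖z 0‖ + 1)) (by positivity)
    refine ⟨N, fun n hn => ?_⟩
    have hD : 0 ≤ z N - z n := sub_nonneg.mpr (hz hn)
    have hDn : ‖z N - z n‖ ≤ ‖z 0‖ + 1 :=
      (CStarAlgebra.norm_le_norm_of_nonneg_of_le hD
        ((sub_le_self _ (h0 n)).trans (hz (Nat.zero_le N)))).trans (by linarith)
    have h1 := norm_apply_sq_le_of_nonneg hD v
    have h2 := hN n hn
    rw [dist_comm, Real.dist_eq] at h2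
    have h3 : (inner ℂ ((z N - z n) v) v).re < ε ^ 2 / (‖z 0‖ + 1) := by
      rw [sub_apply, inner_sub_left, Complex.sub_re]
      exact (le_abs_self _).trans_lt h2
    rw [dist_comm, dist_eq_norm, ← sub_apply]
    refine lt_of_pow_lt_pow_left₀ 2 hε.le (h1.trans_lt ?_)
    have h4 := ((ContinuousLinearMap.nonneg_iff_isPositive _).mp hD).re_inner_nonneg_left v
    calc ‖z N - z n‖ * (inner ℂ ((z N - z n) v) v).re
        ≤ (‖z 0‖ + 1) * (inner ℂ ((z N - z n) v) v).re :=
          mul_le_mul_of_nonneg_right hDn h4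
      _ < (‖z 0‖ + 1) * (ε ^ 2 / (‖z 0‖ + 1)) := by gcongr
      _ = ε ^ 2 := by field_simp
  choose f hf using fun v => cauchySeq_tendsto_of_complete (hC v)
  exact ⟨continuousLinearMapOfTendsto z (tendsto_pi_nhds.mpr hf), hf⟩

omit [InnerProductSpace ℂ H] [CompleteSpace H] in
theorem summable_norm_mul_norm (ξ η : lp (fun _ : ℕ => H) 2) :
    Summable fun n => ‖ξ n‖ * ‖η n‖ := by
  have h := fun ζ : lp (fun _ : ℕ => H) 2 => (lp.memℓp ζ).summable (by norm_num)
  simp only [ENNReal.toReal_ofNat, Real.rpow_ofNat] at h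
  refine .of_nonneg_of_le (fun n => by positivity) (fun n => ?_) ((h ξ).add (h η))
  nlinarith [sq_nonneg (‖ξ n‖ - ‖η n‖), sq_nonneg (‖ξ n‖), sq_nonneg (‖η n‖)]

/-- On norm bounded sequences strong convergence implies `σ`-weak convergence, by dominated
convergence. -/
theorem tendsto_map_of_isNormal {M : VonNeumannAlgebra H} {φ : Alg M →ₗ[ℂ] ℂ} (hφ : IsNormal φ)
    {T : ℕ → Alg M} {S : Alg M} {K : ℝ} (hK : ∀ n, ‖(T n : H →L[ℂ] H)‖ ≤ K)
    (hT : ∀ v, Tendsto (fun n => (T n : H →L[ℂ] H) v) atTop (𝓝 ((S : H →L[ℂ] H) v))) :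
    Tendsto (fun n => φ (T n)) atTop (𝓝 (φ S)) := by
  have key : Tendsto T atTop (@nhds _ (sigmaWeak M) S) := by
    rw [nhds_iInf]
    refine tendsto_iInf.mpr fun ξ => ?_
    rw [nhds_iInf]
    refine tendsto_iInf.mpr fun η => ?_
    rw [nhds_induced, tendsto_comap_iff]
    refine tendsto_tsum_of_dominated_convergence (bound := fun k => K * (‖ξ k‖ * ‖η k‖))
      ((summable_norm_mul_norm ξ η).mul_left K)
      (fun k => tendsto_const_nhds.inner (hT (η k))) (.of_forall fun n k => ?_)
    calc _ ≤ ‖ξ k‖ * ‖(T n : H →L[ℂ] H) (η k)‖ := norm_inner_le_norm _ _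
      _ ≤ ‖ξ k‖ * (K * ‖η k‖) := by
        gcongr
        exact ((T n : H →L[ℂ] H).le_opNorm _).trans (by gcongr; exact hK n)
      _ = K * (‖ξ k‖ * ‖η k‖) := by ring
  exact (@Continuous.tendsto _ _ (sigmaWeak M) _ _ hφ S).comp key

/-- Left multiplication by a fixed element is `σ`-weakly continuous. -/
theorem isNormal_comp_mulLeft {M : VonNeumannAlgebra H} {φ ψ : Alg M →ₗ[ℂ] ℂ} (hφ : IsNormal φ)
    (d : Alg M) (h : ∀ a, ψ a = φ (d * a)) : IsNormal ψ := by
  have hc : @Continuous _ _ (sigmaWeak M) (sigmaWeak M) fun a : Alg M => d * a := by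
    refine continuous_iInf_rng.mpr fun ξ => continuous_iInf_rng.mpr fun η =>
      continuous_induced_rng.mpr ?_
    have hmem : Memℓp (fun n => star (d : H →L[ℂ] H) (ξ n)) 2 := by
      have hξ := (lp.memℓp ξ).summable (by norm_num)
      simp only [ENNReal.toReal_ofNat, Real.rpow_ofNat] at hξ
      refine memℓp_gen ?_
      simp only [ENNReal.toReal_ofNat, Real.rpow_ofNat]
      refine .of_nonneg_of_le (fun n => by positivity) (fun n => ?_)
        (hξ.mul_left (‖star (d : H →L[ℂ] H)‖ ^ 2))
      rw [← mul_pow]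
      exact pow_le_pow_left₀ (norm_nonneg _) (ContinuousLinearMap.le_opNorm _ _) 2
    have e : ultraweakForm M ξ η ∘ (fun a : Alg M => d * a) = ultraweakForm M ⟨_, hmem⟩ η := by
      funext a
      refine tsum_congr fun n => ?_
      change inner ℂ (ξ n) ((d : H →L[ℂ] H) ((a : H →L[ℂ] H) (η n))) = inner ℂ
        (star (d : H →L[ℂ] H) (ξ n)) _
      rw [ContinuousLinearMap.star_eq_adjoint, ContinuousLinearMap.adjoint_inner_left]
    rw [e]
    exact continuous_iInf_dom (continuous_iInf_dom continuous_induced_dom)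
  have : (ψ : Alg M → ℂ) = φ ∘ fun a => d * a := funext h
  rw [IsNormal, this]
  exact @Continuous.comp _ _ _ (sigmaWeak M) (sigmaWeak M) _ _ _ hφ hc

theorem isMonotoneNormal_of_isNormal {M : VonNeumannAlgebra H} (φ : Alg M →ₚ[ℂ] ℂ)
    (hφ : IsNormal (φ : Alg M →ₗ[ℂ] ℂ)) : IsMonotoneNormal φ := by
  intro z hz h0
  obtain ⟨w, hw⟩ := exists_tendsto_of_antitone (z := fun n => (z n : H →L[ℂ] H)) hz h0
  have hcomm : ∀ c : H →L[ℂ] H, (∀ n, Commute c (z n : H →L[ℂ] H)) → Commute c w := fun c hc => by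
    ext v
    refine tendsto_nhds_unique ((c.continuous.tendsto _).comp (hw v)) ((hw (c v)).congr fun n => ?_)
    exact congrArg (fun T : H →L[ℂ] H => T v) (hc n).eq.symm
  have hwM : w ∈ M := mem_of_forall_commute M fun c hc => hcomm c fun n => hc (z n)
  refine ⟨⟨w, hwM⟩, fun x hx => ?_, fun c hc => ?_, fun a b => ?_⟩
  · change (x : H →L[ℂ] H) ≤ w
    rw [ContinuousLinearMap.le_def, ContinuousLinearMap.isPositive_iff_complex]
    intro v
    have hlim : Tendsto (fun n => inner ℂ (((z n : H →L[ℂ] H) - (x : H →L[ℂ] H)) v) v) atTop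
        (𝓝 (inner ℂ ((w - (x : H →L[ℂ] H)) v) v)) :=
      ((hw v).sub tendsto_const_nhds).inner tendsto_const_nhds
    have hnn : 0 ≤ inner ℂ ((w - (x : H →L[ℂ] H)) v) v := ge_of_tendsto' hlim fun n =>
      ((ContinuousLinearMap.le_def _ _).mp (hx n : (x : H →L[ℂ] H) ≤ z n)).inner_nonneg_left v
    exact ⟨Complex.conj_eq_iff_re.mp hnn.star_eq, (Complex.le_def.mp hnn).1⟩
  · exact Subtype.ext (hcomm c fun n => congrArg Subtype.val (hc n).eq).eq
  · refine tendsto_map_of_isNormal hφ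
      (K := ‖(a : H →L[ℂ] H)‖ * ‖(z 0 : H →L[ℂ] H)‖ * ‖(b : H →L[ℂ] H)‖) (fun n => ?_) fun v => ?_
    · refine (norm_mul_le _ _).trans (mul_le_mul_of_nonneg_right ?_ (norm_nonneg _))
      refine (norm_mul_le _ _).trans (mul_le_mul_of_nonneg_left ?_ (norm_nonneg _))
      exact CStarAlgebra.norm_le_norm_of_nonneg_of_le (A := H →L[ℂ] H) (h0 n) (hz (Nat.zero_le n))
    · exact ((a : H →L[ℂ] H).continuous.tendsto _).comp (hw ((b : H →L[ℂ] H) v))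

end Normal

/-! ### Cocycles and invariant densities of states -/

section State

variable {H : Type*} [NormedAddCommGroup H] [InnerProductSpace ℂ H] [CompleteSpace H]
  {M : VonNeumannAlgebra H} {G : Subgroup (Alg M ≃⋆ₐ[ℂ] Alg M)} {φ ψ : Alg M →ₗ[ℂ] ℂ} {d : Alg M}

/-- A state, bundled as a positive linear map for the operator order. -/
noncomputable def IsState.toPositiveLinearMap (hφ : IsState φ) : Alg M →ₚ[ℂ] ℂ :=
  .mk₀ φ fun a ha => by
    obtain ⟨s, rfl⟩ := CStarAlgebra.nonneg_iff_eq_star_mul_self.mp ha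
    exact hφ.nonneg s

theorem IsState.toPositiveLinearMap_apply (hφ : IsState φ) (a : Alg M) :
    hφ.toPositiveLinearMap a = φ a := rfl

theorem IsInvariantDensity.isSelfAdjoint (h : IsInvariantDensity G φ ψ d) : IsSelfAdjoint d :=
  Subtype.ext h.pos.isSelfAdjoint

theorem IsInvariantDensity.commute (h : IsInvariantDensity G φ ψ d) (hφ : IsState φ)
    (hq : IsBoundedStronglyQuasiInvariant G φ) {g : Alg M ≃⋆ₐ[ℂ] Alg M} (hg : g ∈ G) :
    Commute d (g d) := by
  obtain ⟨-, hf, x, hx, hsa, -⟩ := hq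
  refine commute_of_density (φ := hφ.toPositiveLinearMap) hf hx hsa h.isSelfAdjoint
    (fun k a => ?_) ⟨g, hg⟩
  rw [hφ.toPositiveLinearMap_apply, hφ.toPositiveLinearMap_apply, ← h.eq, ← h.eq,
    h.invariant k k.2]

/-- The cocycle is `x g = d * g⁻¹ (d⁻¹)`. -/
theorem IsInvariantDensity.isBoundedStronglyQuasiInvariant (h : IsInvariantDensity G φ ψ d)
    (hφ : IsState φ) (hcomm : ∀ g ∈ G, Commute d (g d)) :
    IsBoundedStronglyQuasiInvariant G φ := by
  obtain ⟨u, hu⟩ := h.isUnit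
  set e : Alg M := ((u⁻¹ : (Alg M)ˣ) : Alg M) with he
  have hde : d * e = 1 := by rw [← hu]; exact u.mul_inv
  have hed : e * d = 1 := by rw [← hu]; exact u.inv_mul
  have hsd := h.isSelfAdjoint
  have hse : IsSelfAdjoint e := by
    rw [IsSelfAdjoint]
    refine left_inv_eq_right_inv (a := d) ?_ hde
    have := congrArg star hde
    rwa [star_mul, hsd.star_eq, star_one] at this
  have hφψ : ∀ a, φ a = ψ (e * a) := fun a => by rw [h.eq, ← mul_assoc, hde, one_mul]
  refine ⟨isNormal_comp_mulLeft h.normal e hφψ, fun a ha => h.faithful a ?_,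
    fun g => d * (g⁻¹ : Alg M ≃⋆ₐ[ℂ] Alg M) e, fun g a => ?_, fun g => ?_,
    ‖d‖ * ‖e‖ + 1, by positivity, fun g => ?_⟩
  · rw [h.eq, ← mul_assoc]
    exact map_mul_eq_zero hφ.toPositiveLinearMap ha _
  · have hinv := h.invariant (g⁻¹ : Alg M ≃⋆ₐ[ℂ] Alg M) (inv_mem g.2)
      (e * (g : Alg M ≃⋆ₐ[ℂ] Alg M) a)
    rw [hφψ, ← hinv, map_mul, ← StarAlgEquiv.mul_apply, inv_mul_cancel, StarAlgEquiv.one_apply,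
      h.eq, mul_assoc]
  · have hc : Commute d ((g⁻¹ : Alg M ≃⋆ₐ[ℂ] Alg M) d) := hcomm _ (inv_mem g.2)
    set k := (g⁻¹ : Alg M ≃⋆ₐ[ℂ] Alg M)
    have hk1 : k d * k e = 1 := by rw [← map_mul, hde, map_one]
    have hk2 : k e * k d = 1 := by rw [← map_mul, hed, map_one]
    have hce : Commute d (k e) := hc.units_inv_right (u := ⟨k d, k e, hk1, hk2⟩)
    exact (hsd.commute_iff (hse.map k)).mp hce
  · have hn : ‖(g⁻¹ : Alg M ≃⋆ₐ[ℂ] Alg M) e‖ = ‖e‖ := StarAlgEquiv.norm_map _ e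
    have := norm_mul_le d ((g⁻¹ : Alg M ≃⋆ₐ[ℂ] Alg M) e)
    rw [hn] at this
    linarith

theorem IsBoundedStronglyQuasiInvariant.exists_isInvariantDensity (hφ : IsState φ)
    (hq : IsBoundedStronglyQuasiInvariant G φ) :
    ∃ (ψ : Alg M →ₗ[ℂ] ℂ) (d : Alg M), IsInvariantDensity G φ ψ d := by
  obtain ⟨hnor, hf, x, hx, hsa, c, -, hbd⟩ := hq
  set Φ := hφ.toPositiveLinearMap with hΦ
  have hΦφ : ∀ a, Φ a = φ a := fun _ => rfl
  obtain ⟨d, hdc, hd1, hfix⟩ := exists_fixed_density (φ := Φ)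
    (isMonotoneNormal_of_isNormal Φ hnor) hf hx hsa hbd
  have hd0 : 0 ≤ d := zero_le_one.trans hd1
  have hmul : ∀ a, φ (star a * a) ≤ φ (d * (star a * a)) := fun a => by
    have h := map_mul_nonneg (sub_mem hdc (one_mem _)) (sub_nonneg.mpr hd1)
      (star_mul_self_nonneg a)
    rwa [sub_mul, one_mul, map_sub, sub_nonneg] at h
  have hφd : 1 ≤ φ d := by
    have h := hmul 1
    rwa [star_one, mul_one, mul_one, hφ.map_one] at h
  have hr : 0 < (φ d)⁻¹ := by
    have := zero_lt_one.trans_le hφd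
    exact inv_pos.mpr this
  set r := (φ d)⁻¹ with hrdef
  refine ⟨φ ∘ₗ LinearMap.mulLeft ℂ (r • d), r • d, ?_⟩
  have hψ : ∀ a, (φ ∘ₗ LinearMap.mulLeft ℂ (r • d)) a = r * φ (d * a) := fun a => by
    simp
  have hpos : 0 ≤ r • d := smul_nonneg hr.le hd0
  refine ⟨⟨fun a => ?_, ?_⟩, isNormal_comp_mulLeft hnor _ fun _ => rfl, fun a ha => ?_,
    fun g hg a => ?_, (ContinuousLinearMap.nonneg_iff_isPositive _).mp hpos, ?_, fun _ => rfl⟩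
  · rw [hψ]
    exact mul_nonneg hr.le ((hφ.nonneg a).trans (hmul a))
  · rw [hψ, mul_one]
    exact inv_mul_cancel₀ (zero_lt_one.trans_le hφd).ne'
  · rw [hψ] at ha
    have h0 := (mul_eq_zero.mp ha).resolve_left hr.ne'
    exact hf a (le_antisymm ((hmul a).trans h0.le) (hφ.nonneg a))
  · rw [hψ, hψ]
    have h := hx ⟨g, hg⟩ ((g⁻¹ : Alg M ≃⋆ₐ[ℂ] Alg M) d * a)
    have h1 := hfix ⟨g, hg⟩
    simp only at h h1
    rw [map_mul, ← mul_assoc, h1, ← StarAlgEquiv.mul_apply, mul_inv_cancel,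
      StarAlgEquiv.one_apply] at h
    rw [h]
  · exact (CStarAlgebra.isUnit_of_le 1 hd1).smul (Units.mk0 r hr.ne')

end State

end QuasiInvariantState

theorem theorem3p3 {H : Type*} [NormedAddCommGroup H] [InnerProductSpace ℂ H] [CompleteSpace H]
    (M : VonNeumannAlgebra H)
    (G : Subgroup (QuasiInvariantState.Alg M ≃⋆ₐ[ℂ] QuasiInvariantState.Alg M))
    (hG : ∀ g ∈ G, QuasiInvariantState.IsNormalAut g)
    (φ : QuasiInvariantState.Alg M →ₗ[ℂ] ℂ) (hφ : QuasiInvariantState.IsState φ) :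
    (QuasiInvariantState.IsBoundedStronglyQuasiInvariant G φ ↔
      ∃ (ψ : QuasiInvariantState.Alg M →ₗ[ℂ] ℂ) (d : QuasiInvariantState.Alg M),
        QuasiInvariantState.IsInvariantDensity G φ ψ d ∧ ∀ g ∈ G, Commute d (g d)) ∧
    (QuasiInvariantState.IsBoundedStronglyQuasiInvariant G φ →
      ∀ (ψ : QuasiInvariantState.Alg M →ₗ[ℂ] ℂ) (d : QuasiInvariantState.Alg M),
        QuasiInvariantState.IsInvariantDensity G φ ψ d → ∀ g ∈ G, Commute d (g d)) := by
  refine ⟨⟨fun hq => ?_, fun ⟨ψ, d, hd, hcomm⟩ => hd.isBoundedStronglyQuasiInvariant hφ hcomm⟩,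
    fun hq ψ d hd g hg => hd.commute hφ hq hg⟩
  obtain ⟨ψ, d, hd⟩ := hq.exists_isInvariantDensity hφ
  exact ⟨ψ, d, hd, fun g hg => hd.commute hφ hq hg⟩
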